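/- Let $k$ be a field, $A$ an associative unital $k$-algebra, $B$ a commutative $k$-algebra, and $\varepsilon:B\to A$ a morphism of $k$-algebras whose image lies in the centre of $A$; write $\otimes=\otimes_k$. **Secondary cohomology.** For an $A$-bimodule $M$ let $C^n((A,B,\varepsilon);M)=\mathrm{Hom}_k(A^{\otimes n}\otimes B^{\otimes n(n-1)/2},M)$. An elementary tensor is written as an upper triangular matrix with diagonal entries $a_0,\dots,a_{n-1}\in A$ and entries $b_{u,v}\in B$ for $0\le u<v\le n-1$. The differential $\delta_n^{\varepsilon}:C^n\to C^{n+1}$ is $$\delta_n^{\varepsilon}f=d_0f+\sum_{i=1}^{n}(-1)^{i}d_if+(-1)^{n+1}d_{n+1}f .$$ Here, on a matrix with entries $a_u$, $b_{u,v}$ ($0\le u<v\le n$): $d_0f$ is $a_0\,\varepsilon(b_{0,1}\cdots b_{0,n})$ times the value of $f$ on the matrix with row and column $0$ deleted; $d_{n+1}f$ is $\varepsilon(b_{0,n}\cdots b_{n-1,n})$ times the value of $f$ on the matrix with row and column $n$ deleted, times $a_n$ on the right; and for $1\le i\le n$, $d_if$ is the value of $f$ on the $n\times n$ matrix obtained by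 multiplying rows $i-1$ and $i$ and columns $i-1$ and $i$, whose merged diagonal entry is $\varepsilon(b_{i-1,i})a_{i-1}a_i$. Put $Z^n=\ker\delta^\varepsilon_n$ and let $H^n((A,B,\varepsilon);M)$ be the quotient of $Z^n$ by the image of $\delta^\varepsilon_{n-1}$. **Families of products.** For a sequence $c=(c_i)_{i\ge1}$ of $k$-linear maps $c_i:A\otimes A\otimes B\to A$ (elements of $C^2((A,B,\varepsilon);A)$) let $\mathcal M^c=\{m^c_{\alpha,t}\}_{\alpha\in B}$ be the family of products on $A[[t]]$ obtained by $t$-bilinear extension (that is, coefficientwise in $A[[t]]$) from $$m^c_{\alpha,t}(a\otimes b)=\varepsilon(\alpha)ab+\sum_{i\ge1}c_i(a\otimes b\otimes\alpha)\,t^i\qquad(a,b\in A).$$ $\mathcal M^c$ is *associative mod $t^N$* if $m^c_{\alpha\beta,t}(\mathrm{id}\otimes m^c_{\gamma,t})\equiv m^c_{\beta\gamma,t}(m^c_{\alpha,t}\otimes\mathrm{id})$ mod $t^N$ for all $\alpha,\beta,\gamma\in B$. Two families $\mathcal M^c$ and $\mathcal M^d$ are *isomorphic* if there is a $k[[t]]$-linear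 bijection $\varphi$ of $A[[t]]$ with $\varphi(a)\equiv a$ mod $t$ for $a\in A$ and $\varphi(m^c_{\alpha,t}(x\otimes y))=m^d_{\alpha,t}(\varphi(x)\otimes\varphi(y))$ for all $x,y\in A[[t]]$, $\alpha\in B$. For $f,g:A\otimes A\otimes B\to A$ let $f\,\overline\circ\, g\in C^3((A,B,\varepsilon);A)$ be the map whose value on the matrix with diagonal $a,b,c$ and $b_{0,1}=\alpha$, $b_{0,2}=\beta$, $b_{1,2}=\gamma$ is $$f(g(a\otimes b\otimes\alpha)\otimes c\otimes\beta\gamma)-f(a\otimes g(b\otimes c\otimes\gamma)\otimes\alpha\beta).$$ **Theorem.** (i) For every sequence $c$, the family $\mathcal M^c$ is associative mod $t^2$ if and only if $c_1\in Z^2((A,B,\varepsilon);A)$. Moreover the class of $c_1$ depends only on the isomorphism class of the family: if $\mathcal M^c$ is associative mod $t^2$ and $\mathcal M^d$ is isomorphic to $\mathcal M^c$, then $c_1$ and $d_1$ are both $2$-cocycles and $[c_1]=[d_1]$ in $H^2((A,B,\varepsilon);A)$. (ii) Let $n\ge0$ and let $\mathcal M^c$ be associative mod $t^{n+1}$. Then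 $\Omega=c_1\overline\circ c_n+c_2\overline\circ c_{n-1}+\dots+c_n\overline\circ c_1$ lies in $Z^3((A,B,\varepsilon);A)$, and there is a sequence $c'$ with $c'_i=c_i$ for $1\le i\le n$ such that $\mathcal M^{c'}$ is associative mod $t^{n+2}$ if and only if $[\Omega]=0$ in $H^3((A,B,\varepsilon);A)$. -/

import Mathlib

open scoped PowerSeries TensorProduct

namespace SecondaryHochschild

/-- The positions `(u, v)`, `u < v`, strictly above the diagonal of an `n × n` matrix. -/
abbrev Pairs (n : ℕ) : Type := {p : Fin n × Fin n // p.1 < p.2}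

/-- The position `(u, v)`. -/
abbrev pos {n : ℕ} (u v : Fin n) (h : u < v) : Pairs n := ⟨(u, v), h⟩

/-- `C^n((A, B, ε); M) = Hom_k(A^{⊗ n} ⊗ B^{⊗ n(n-1)/2}, M)`. -/
abbrev Cochain (k A B M : Type*) [Field k] [Ring A] [Algebra k A] [CommRing B] [Algebra k B]
    [AddCommGroup M] [Module k M] (n : ℕ) :=
  ((⨂[k] _ : Fin n, A) ⊗[k] (⨂[k] _ : Pairs n, B)) →ₗ[k] M

section Complex

variable {k A B M : Type*} [Field k] [Ring A] [Algebra k A] [CommRing B] [Algebra k B]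
  [AddCommGroup M] [Module k M]

/-- The value of a cochain on the tensor matrix with entries `a u` on the diagonal and entries
`b (u, v)` above it. -/
def Cochain.eval {n : ℕ} (f : Cochain k A B M n) (a : Fin n → A) (b : Pairs n → B) : M :=
  f ((PiTensorProduct.tprod k a) ⊗ₜ[k] (PiTensorProduct.tprod k b))

theorem Cochain.ext_eval {n : ℕ} {f g : Cochain k A B M n}
    (h : ∀ a b, f.eval a b = g.eval a b) : f = g := by
  apply TensorProduct.ext
  apply PiTensorProduct.ext
  ext a : 1
  apply PiTensorProduct.ext
  ext b
  exact h a b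

@[simp]
theorem Cochain.eval_add {n : ℕ} (f g : Cochain k A B M n) (a : Fin n → A) (b : Pairs n → B) :
    (f + g).eval a b = f.eval a b + g.eval a b := rfl

@[simp]
theorem Cochain.eval_smul {n : ℕ} (r : k) (f : Cochain k A B M n) (a : Fin n → A)
    (b : Pairs n → B) : (r • f).eval a b = r • f.eval a b := rfl

/-- The linear map on tensors defined by a function of a matrix that is `k`-linear in each entry. -/
noncomputable def Cochain.ofFun {n : ℕ} (F : (Fin n → A) → (Pairs n → B) → M)
    (hA : ∀ a b j, ∃ L : A →ₗ[k] M, ∀ x, F (Function.update a j x) b = L x)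
    (hB : ∀ a b p, ∃ L : B →ₗ[k] M, ∀ x, F a (Function.update b p x) = L x) :
    Cochain k A B M n :=
  TensorProduct.lift (PiTensorProduct.lift (MultilinearMap.mk'
    (fun a => PiTensorProduct.lift (MultilinearMap.mk' (fun b => F a b)
      (fun b p x y => by obtain ⟨L, hL⟩ := hB a b p; simp only [hL, map_add])
      (fun b p r x => by obtain ⟨L, hL⟩ := hB a b p; simp only [hL, map_smul])))
    (fun a j x y => by
      apply PiTensorProduct.ext
      ext b; obtain ⟨L, hL⟩ := hA a b j
      simp [MultilinearMap.mk', hL])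
    (fun a j r x => by
      apply PiTensorProduct.ext
      ext b; obtain ⟨L, hL⟩ := hA a b j
      simp [MultilinearMap.mk', hL])))

@[simp]
theorem Cochain.eval_ofFun {n : ℕ} (F : (Fin n → A) → (Pairs n → B) → M) (hA) (hB)
    (a : Fin n → A) (b : Pairs n → B) : (Cochain.ofFun (k := k) F hA hB).eval a b = F a b := by
  simp [Cochain.ofFun, Cochain.eval, MultilinearMap.mk']

/-- The `k`-linear dependence of a cochain on one diagonal entry. -/
theorem Cochain.linear_diag {n : ℕ} (f : Cochain k A B M n) (a : Fin n → A) (b : Pairs n → B)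
    (j : Fin n) : ∃ L : A →ₗ[k] M, ∀ x, f.eval (Function.update a j x) b = L x :=
  ⟨f ∘ₗ (TensorProduct.mk k _ _).flip (PiTensorProduct.tprod k b) ∘ₗ
    (PiTensorProduct.tprod k).toLinearMap a j, fun _ => rfl⟩

/-- The `k`-linear dependence of a cochain on one entry above the diagonal. -/
theorem Cochain.linear_upper {n : ℕ} (f : Cochain k A B M n) (a : Fin n → A) (b : Pairs n → B)
    (p : Pairs n) : ∃ L : B →ₗ[k] M, ∀ x, f.eval a (Function.update b p x) = L x :=
  ⟨f ∘ₗ TensorProduct.mk k _ _ (PiTensorProduct.tprod k a) ∘ₗ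
    (PiTensorProduct.tprod k).toLinearMap b p, fun _ => rfl⟩

/-! ### The faces of a tensor matrix

Rows and columns are numbered from `0`. For `i : Fin n` the `i`-th inner face of an
`(n+1) × (n+1)` matrix multiplies row `i` by row `i + 1` and column `i` by column `i + 1`.
Row `u` of the result comes from the rows `lo i u` and `hi i u` of the given matrix; these two are
`i` and `i + 1` for `u = i`, and they are equal for `u ≠ i`. -/

/-- `lo i u = u` for `u ≤ i`, and `u + 1` for `u > i`. -/
def lo {n : ℕ} (i u : Fin n) : Fin (n + 1) := i.succ.succAbove u

/-- `hi i u = u` for `u < i`, and `u + 1` for `u ≥ i`. -/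
def hi {n : ℕ} (i u : Fin n) : Fin (n + 1) := i.castSucc.succAbove u

theorem lo_val {n : ℕ} (i u : Fin n) :
    (lo i u : ℕ) = if (u : ℕ) ≤ i then (u : ℕ) else u + 1 := by
  simp only [lo, Fin.succAbove, Fin.lt_def, Fin.val_castSucc, Fin.val_succ, Nat.lt_succ_iff]
  split_ifs <;> simp

theorem hi_val {n : ℕ} (i u : Fin n) :
    (hi i u : ℕ) = if (u : ℕ) < i then (u : ℕ) else u + 1 := by
  simp only [hi, Fin.succAbove, Fin.lt_def, Fin.val_castSucc]
  split_ifs <;> simp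

theorem lo_lt_lo {n : ℕ} (i : Fin n) {u v : Fin n} (h : u < v) : lo i u < lo i v := by
  rw [Fin.lt_def] at *; rw [lo_val, lo_val]; split_ifs <;> omega

theorem hi_lt_hi {n : ℕ} (i : Fin n) {u v : Fin n} (h : u < v) : hi i u < hi i v := by
  rw [Fin.lt_def] at *; rw [hi_val, hi_val]; split_ifs <;> omega

theorem lo_self_lt_hi_self {n : ℕ} (i : Fin n) : lo i i < hi i i := by
  rw [Fin.lt_def, lo_val, hi_val]; simp

/-- The diagonal of the `i`-th inner face: entry `i` is `ε(b_{i,i+1}) a_i a_{i+1}`. -/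
def faceDiag (ε : B →ₐ[k] A) {n : ℕ} (i : Fin n) (a : Fin (n + 1) → A) (b : Pairs (n + 1) → B) :
    Fin n → A :=
  fun u => if u = i then ε (b (pos (lo i i) (hi i i) (lo_self_lt_hi_self i))) *
    (a (lo i i) * a (hi i i)) else a (lo i u)

/-- The entries above the diagonal of the `i`-th inner face: the entry `(u, v)` is
`b_{i,v+1} b_{i+1,v+1}` for `u = i < v`, it is `b_{u,i} b_{u,i+1}` for `u < i = v`, and it is
a single entry of the given matrix if `i` is neither `u` nor `v`. -/
def faceUpper {n : ℕ} (i : Fin n) (b : Pairs (n + 1) → B) : Pairs n → B :=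
  fun p =>
    if p.1.1 = i ∨ p.1.2 = i then
      b (pos (lo i p.1.1) (lo i p.1.2) (lo_lt_lo i p.2)) *
        b (pos (hi i p.1.1) (hi i p.1.2) (hi_lt_hi i p.2))
    else b (pos (lo i p.1.1) (lo i p.1.2) (lo_lt_lo i p.2))

theorem faceDiag_update_diag (ε : B →ₐ[k] A) {n : ℕ} (i : Fin n) (a : Fin (n + 1) → A)
    (b : Pairs (n + 1) → B) (j : Fin (n + 1)) :
    ∃ (u : Fin n) (L : A →ₗ[k] A), ∀ x,
      faceDiag ε i (Function.update a j x) b = Function.update (faceDiag ε i a b) u (L x) := by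
  have hne : lo i i ≠ hi i i := (lo_self_lt_hi_self i).ne
  by_cases h1 : j = lo i i
  · refine ⟨i, LinearMap.mulLeft k (ε (b (pos (lo i i) (hi i i) (lo_self_lt_hi_self i)))) ∘ₗ
      LinearMap.mulRight k (a (hi i i)), fun x => ?_⟩
    funext u
    by_cases hu : u = i
    · subst hu; subst h1; simp [faceDiag, hne.symm]
    · have : lo i u ≠ j := by
        subst h1; intro h; exact hu (Fin.succAbove_right_injective h)
      simp [faceDiag, hu, this]
  by_cases h2 : j = hi i i
  · refine ⟨i, LinearMap.mulLeft k (ε (b (pos (lo i i) (hi i i) (lo_self_lt_hi_self i)))) ∘ₗ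
      LinearMap.mulLeft k (a (lo i i)), fun x => ?_⟩
    funext u
    by_cases hu : u = i
    · subst hu; subst h2; simp [faceDiag, hne]
    · have : lo i u ≠ j := by
        subst h2; intro h
        have h' := congrArg Fin.val h
        have hu' : (u : ℕ) ≠ i := fun h => hu (Fin.ext h)
        rw [lo_val, hi_val] at h'; split_ifs at h' <;> omega
      simp [faceDiag, hu, this]
  · obtain ⟨u₀, hu₀⟩ : ∃ u₀, lo i u₀ = j := by
      refine Fin.exists_succAbove_eq ?_
      intro h; apply h2; rw [h]; apply Fin.ext; rw [hi_val]; simp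
    have hu₀i : u₀ ≠ i := by rintro rfl; exact h1 hu₀.symm
    refine ⟨u₀, LinearMap.id, fun x => ?_⟩
    funext u
    by_cases hu : u = i
    · subst hu; simp [faceDiag, Ne.symm h1, Ne.symm h2, hu₀i.symm]
    · by_cases huu : u = u₀
      · subst huu; subst hu₀; simp [faceDiag, hu]
      · have : lo i u ≠ j := by
          subst hu₀; intro h; exact huu (Fin.succAbove_right_injective h)
        simp [faceDiag, hu, huu, this]

theorem pos_eq_iff {n : ℕ} (p : Pairs n) (u v : Fin n) (h : u < v) :
    pos u v h = p ↔ (u : ℕ) = p.1.1 ∧ (v : ℕ) = p.1.2 := by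
  obtain ⟨⟨r, s⟩, hp⟩ := p
  simp [pos, Fin.ext_iff]

theorem pos_cases {n : ℕ} (i : Fin n) (p : Pairs (n + 1)) :
    p = pos (lo i i) (hi i i) (lo_self_lt_hi_self i) ∨
    (∃ q : Pairs n, pos (lo i q.1.1) (lo i q.1.2) (lo_lt_lo i q.2) = p) ∨
    (∃ q : Pairs n, (q.1.1 = i ∨ q.1.2 = i) ∧
      pos (hi i q.1.1) (hi i q.1.2) (hi_lt_hi i q.2) = p) := by
  obtain ⟨⟨r, s⟩, hp⟩ := p
  have hp' : (r : ℕ) < s := hp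
  have hi' := i.2
  have hr := r.2
  have hs := s.2
  by_cases h : (r : ℕ) = i ∧ (s : ℕ) = i + 1
  · left; symm; rw [pos_eq_iff, lo_val, hi_val]; simp [h]
  right
  by_cases h1 : (r : ℕ) ≠ i + 1 ∧ (s : ℕ) ≠ i + 1
  · left
    refine ⟨⟨(⟨if (r : ℕ) ≤ i then r else r - 1, by split_ifs <;> omega⟩,
      ⟨if (s : ℕ) ≤ i then s else s - 1, by split_ifs <;> omega⟩), ?_⟩, ?_⟩
    · simp only [Fin.lt_def]; split_ifs <;> omega
    · rw [pos_eq_iff, lo_val, lo_val]; dsimp only; constructor <;> split_ifs <;> omega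
  · right
    refine ⟨⟨(⟨if (r : ℕ) ≤ i then r else r - 1, by split_ifs <;> omega⟩,
      ⟨if (s : ℕ) ≤ i then s else s - 1, by split_ifs <;> omega⟩), ?_⟩, ?_, ?_⟩
    · simp only [Fin.lt_def]; split_ifs <;> omega
    · simp only [Fin.ext_iff]; split_ifs <;> omega
    · rw [pos_eq_iff, hi_val, hi_val]; dsimp only; constructor <;> split_ifs <;> omega

theorem face_update_upper (ε : B →ₐ[k] A) {n : ℕ} (i : Fin n) (a : Fin (n + 1) → A)
    (b : Pairs (n + 1) → B) (p : Pairs (n + 1)) :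
    (∃ L : B →ₗ[k] A, ∀ x,
      faceDiag ε i a (Function.update b p x) = Function.update (faceDiag ε i a b) i (L x) ∧
      faceUpper i (Function.update b p x) = faceUpper i b) ∨
    (∃ (q : Pairs n) (L : B →ₗ[k] B), ∀ x,
      faceDiag ε i a (Function.update b p x) = faceDiag ε i a b ∧
      faceUpper i (Function.update b p x) = Function.update (faceUpper i b) q (L x)) := by
  rcases pos_cases i p with rfl | ⟨q, rfl⟩ | ⟨q, hq, rfl⟩
  · left
    refine ⟨LinearMap.mulRight k (a (lo i i) * a (hi i i)) ∘ₗ ε.toLinearMap, fun x => ⟨?_, ?_⟩⟩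
    · funext u
      by_cases hu : u = i
      · subst hu; simp [faceDiag, mul_assoc]
      · simp [faceDiag, hu]
    · funext q
      have hq := q.2
      have h1 : pos (lo i q.1.1) (lo i q.1.2) (lo_lt_lo i q.2) ≠
          pos (lo i i) (hi i i) (lo_self_lt_hi_self i) := by
        rw [Ne, pos_eq_iff]; simp only [lo_val, hi_val]; rw [Fin.lt_def] at hq
        split_ifs <;> omega
      have h2 : pos (hi i q.1.1) (hi i q.1.2) (hi_lt_hi i q.2) ≠
          pos (lo i i) (hi i i) (lo_self_lt_hi_self i) := by
        rw [Ne, pos_eq_iff]; simp only [lo_val, hi_val]; rw [Fin.lt_def] at hq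
        split_ifs <;> omega
      simp only [faceUpper, Function.update_of_ne h1, Function.update_of_ne h2]
  · right
    have hd : pos (lo i i) (hi i i) (lo_self_lt_hi_self i) ≠
        pos (lo i q.1.1) (lo i q.1.2) (lo_lt_lo i q.2) := by
      have hq := q.2
      rw [Ne, pos_eq_iff]; simp only [lo_val, hi_val]; rw [Fin.lt_def] at hq
      split_ifs <;> omega
    have h1 : ∀ q' : Pairs n, q' ≠ q → pos (lo i q'.1.1) (lo i q'.1.2) (lo_lt_lo i q'.2) ≠
        pos (lo i q.1.1) (lo i q.1.2) (lo_lt_lo i q.2) := by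
      intro q' hne
      rw [Ne, pos_eq_iff]; simp only [lo_val]
      intro h; apply hne
      apply Subtype.ext; apply Prod.ext <;> apply Fin.ext <;> split_ifs at h <;> omega
    have h2 : ∀ q' : Pairs n, (q'.1.1 = i ∨ q'.1.2 = i) →
        pos (hi i q'.1.1) (hi i q'.1.2) (hi_lt_hi i q'.2) ≠
        pos (lo i q.1.1) (lo i q.1.2) (lo_lt_lo i q.2) := by
      intro q' hor
      simp only [Fin.ext_iff] at hor
      rw [Ne, pos_eq_iff]; simp only [lo_val, hi_val]
      intro h; split_ifs at h <;> omega
    by_cases hor : q.1.1 = i ∨ q.1.2 = i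
    · refine ⟨q, LinearMap.mulRight k (b (pos (hi i q.1.1) (hi i q.1.2) (hi_lt_hi i q.2))),
        fun x => ⟨?_, ?_⟩⟩
      · funext u; simp only [faceDiag, Function.update_of_ne hd]
      · funext q'
        by_cases hqq : q' = q
        · subst hqq
          simp only [faceUpper, if_pos hor, Function.update_self, Function.update_of_ne (h2 _ hor),
            LinearMap.mulRight_apply]
        · rw [Function.update_of_ne hqq]
          simp only [faceUpper, Function.update_of_ne (h1 q' hqq)]
          split_ifs with h
          · rw [Function.update_of_ne (h2 q' h)]
          · rfl
    · refine ⟨q, LinearMap.id, fun x => ⟨?_, ?_⟩⟩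
      · funext u; simp only [faceDiag, Function.update_of_ne hd]
      · funext q'
        by_cases hqq : q' = q
        · subst hqq
          simp only [faceUpper, if_neg hor, Function.update_self, LinearMap.id_apply]
        · rw [Function.update_of_ne hqq]
          simp only [faceUpper, Function.update_of_ne (h1 q' hqq)]
          split_ifs with h
          · rw [Function.update_of_ne (h2 q' h)]
          · rfl
  · right
    have hd : pos (lo i i) (hi i i) (lo_self_lt_hi_self i) ≠
        pos (hi i q.1.1) (hi i q.1.2) (hi_lt_hi i q.2) := by
      have hq' := q.2
      rw [Ne, pos_eq_iff]; simp only [lo_val, hi_val]; rw [Fin.lt_def] at hq'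
      split_ifs <;> omega
    have h1 : ∀ q' : Pairs n, q' ≠ q → pos (hi i q'.1.1) (hi i q'.1.2) (hi_lt_hi i q'.2) ≠
        pos (hi i q.1.1) (hi i q.1.2) (hi_lt_hi i q.2) := by
      intro q' hne
      rw [Ne, pos_eq_iff]; simp only [hi_val]
      intro h; apply hne
      apply Subtype.ext; apply Prod.ext <;> apply Fin.ext <;> split_ifs at h <;> omega
    have h2 : ∀ q' : Pairs n, pos (lo i q'.1.1) (lo i q'.1.2) (lo_lt_lo i q'.2) ≠
        pos (hi i q.1.1) (hi i q.1.2) (hi_lt_hi i q.2) := by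
      intro q'
      simp only [Fin.ext_iff] at hq
      rw [Ne, pos_eq_iff]; simp only [lo_val, hi_val]
      intro h; split_ifs at h <;> omega
    refine ⟨q, LinearMap.mulLeft k (b (pos (lo i q.1.1) (lo i q.1.2) (lo_lt_lo i q.2))),
      fun x => ⟨?_, ?_⟩⟩
    · funext u; simp only [faceDiag, Function.update_of_ne hd]
    · funext q'
      by_cases hqq : q' = q
      · subst hqq
        simp only [faceUpper, if_pos hq, Function.update_self, Function.update_of_ne (h2 _),
          LinearMap.mulLeft_apply]
      · rw [Function.update_of_ne hqq]
        simp only [faceUpper, Function.update_of_ne (h1 q' hqq), Function.update_of_ne (h2 q')]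

/-! ### The differential -/

variable [Module A M] [IsScalarTower k A M] [Module Aᵐᵒᵖ M] [IsScalarTower k Aᵐᵒᵖ M]
  [SMulCommClass A Aᵐᵒᵖ M]

/-- The first term `a_0 ε(b_{0,1} ⋯ b_{0,n}) f(…)`: row `0` and column `0` are deleted. -/
noncomputable def firstTerm (ε : B →ₐ[k] A) {n : ℕ} (f : Cochain k A B M n) : Cochain k A B M (n + 1) :=
  Cochain.ofFun
    (fun a b => (a 0 * ε (∏ j : Fin n, b (pos 0 j.succ (Fin.succ_pos j)))) •
      f.eval (fun u => a u.succ)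
        (fun p => b (pos p.1.1.succ p.1.2.succ (Fin.succ_lt_succ_iff.mpr p.2))))
    (by
      intro a b j
      rcases Fin.eq_zero_or_eq_succ j with rfl | ⟨j, rfl⟩
      · refine ⟨(LinearMap.toSpanSingleton A M (f.eval (fun u => a u.succ)
          (fun p => b (pos p.1.1.succ p.1.2.succ (Fin.succ_lt_succ_iff.mpr p.2))))).restrictScalars
            k ∘ₗ LinearMap.mulRight k (ε (∏ j : Fin n, b (pos 0 j.succ (Fin.succ_pos j)))),
          fun x => ?_⟩
        simp
      · obtain ⟨L, hL⟩ := f.linear_diag (fun u => a u.succ)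
          (fun p => b (pos p.1.1.succ p.1.2.succ (Fin.succ_lt_succ_iff.mpr p.2))) j
        refine ⟨Algebra.lsmul k k M
          (a 0 * ε (∏ j : Fin n, b (pos 0 j.succ (Fin.succ_pos j)))) ∘ₗ L, fun x => ?_⟩
        have h : (fun u : Fin n => Function.update a j.succ x u.succ) =
            Function.update (fun u : Fin n => a u.succ) j x := by
          funext u
          by_cases hu : u = j
          · subst hu; simp
          · simp [hu]
        rw [h, hL, Function.update_of_ne (Fin.succ_ne_zero j).symm]
        rfl)
    (by
      intro a b p
      obtain ⟨⟨r, s⟩, hp⟩ := p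
      obtain ⟨s, rfl⟩ := Fin.exists_succ_eq.mpr (Fin.ne_zero_of_lt hp)
      rcases Fin.eq_zero_or_eq_succ r with rfl | ⟨r, rfl⟩
      · refine ⟨(LinearMap.toSpanSingleton A M (f.eval (fun u => a u.succ)
          (fun p => b (pos p.1.1.succ p.1.2.succ (Fin.succ_lt_succ_iff.mpr p.2))))).restrictScalars
            k ∘ₗ LinearMap.mulLeft k (a 0) ∘ₗ ε.toLinearMap ∘ₗ
              (MultilinearMap.mkPiAlgebra k (Fin n) B).toLinearMap
                (fun j : Fin n => b (pos 0 j.succ (Fin.succ_pos j))) s, fun x => ?_⟩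
        have h1 : (fun j : Fin n =>
              Function.update b ⟨(0, s.succ), hp⟩ x (pos 0 j.succ (Fin.succ_pos j))) =
            Function.update (fun j : Fin n => b (pos 0 j.succ (Fin.succ_pos j))) s x := by
          funext j
          by_cases hj : j = s
          · subst hj; simp
          · rw [Function.update_of_ne hj, Function.update_of_ne]
            simp [pos, hj]
        have h2 : ∀ p : Pairs n, Function.update b ⟨(0, s.succ), hp⟩ x
              (pos p.1.1.succ p.1.2.succ (Fin.succ_lt_succ_iff.mpr p.2)) =
            b (pos p.1.1.succ p.1.2.succ (Fin.succ_lt_succ_iff.mpr p.2)) := by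
          intro p
          rw [Function.update_of_ne]
          simp [pos]
        simp only [h1, h2]
        simp
      · obtain ⟨L, hL⟩ := f.linear_upper (fun u => a u.succ)
          (fun p => b (pos p.1.1.succ p.1.2.succ (Fin.succ_lt_succ_iff.mpr p.2)))
          ⟨(r, s), Fin.succ_lt_succ_iff.mp hp⟩
        refine ⟨Algebra.lsmul k k M
          (a 0 * ε (∏ j : Fin n, b (pos 0 j.succ (Fin.succ_pos j)))) ∘ₗ L, fun x => ?_⟩
        have h1 : ∀ j : Fin n, Function.update b ⟨(r.succ, s.succ), hp⟩ x
            (pos 0 j.succ (Fin.succ_pos j)) = b (pos 0 j.succ (Fin.succ_pos j)) := by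
          intro j
          rw [Function.update_of_ne]
          simp [pos, (Fin.succ_ne_zero r).symm]
        have h2 : (fun p : Pairs n => Function.update b ⟨(r.succ, s.succ), hp⟩ x
              (pos p.1.1.succ p.1.2.succ (Fin.succ_lt_succ_iff.mpr p.2))) =
            Function.update (fun p : Pairs n =>
              b (pos p.1.1.succ p.1.2.succ (Fin.succ_lt_succ_iff.mpr p.2)))
              ⟨(r, s), Fin.succ_lt_succ_iff.mp hp⟩ x := by
          funext p
          by_cases hq : p = ⟨(r, s), Fin.succ_lt_succ_iff.mp hp⟩
          · subst hq; simp [pos]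
          · rw [Function.update_of_ne hq, Function.update_of_ne]
            intro h; apply hq
            simp only [pos, Subtype.mk.injEq, Prod.mk.injEq, Fin.succ_inj] at h
            exact Subtype.ext (Prod.ext h.1 h.2)
        simp only [h1, h2, hL]
        rfl)

/-- The term in which row `i` is multiplied by row `i + 1` and column `i` by column `i + 1`. -/
noncomputable def innerTerm (ε : B →ₐ[k] A) {n : ℕ} (i : Fin n) (f : Cochain k A B M n) :
    Cochain k A B M (n + 1) :=
  Cochain.ofFun (fun a b => f.eval (faceDiag ε i a b) (faceUpper i b))
    (by
      intro a b j
      obtain ⟨u, L, hL⟩ := faceDiag_update_diag ε i a b j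
      obtain ⟨L', hL'⟩ := f.linear_diag (faceDiag ε i a b) (faceUpper i b) u
      exact ⟨L' ∘ₗ L, fun x => by rw [hL, hL']; rfl⟩)
    (by
      intro a b p
      rcases face_update_upper ε i a b p with ⟨L, hL⟩ | ⟨q, L, hL⟩
      · obtain ⟨L', hL'⟩ := f.linear_diag (faceDiag ε i a b) (faceUpper i b) i
        exact ⟨L' ∘ₗ L, fun x => by rw [(hL x).1, (hL x).2, hL']; rfl⟩
      · obtain ⟨L', hL'⟩ := f.linear_upper (faceDiag ε i a b) (faceUpper i b) q
        exact ⟨L' ∘ₗ L, fun x => by rw [(hL x).1, (hL x).2, hL']; rfl⟩)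

/-- The last term `ε(b_{0,n} ⋯ b_{n-1,n}) f(…) a_n`: row `n` and column `n` are deleted. -/
noncomputable def lastTerm (ε : B →ₐ[k] A) {n : ℕ} (f : Cochain k A B M n) : Cochain k A B M (n + 1) :=
  Cochain.ofFun
    (fun a b => ε (∏ j : Fin n, b (pos j.castSucc (Fin.last n) (Fin.castSucc_lt_last j))) •
      (MulOpposite.op (a (Fin.last n)) • f.eval (fun u => a u.castSucc)
        (fun p => b (pos p.1.1.castSucc p.1.2.castSucc (Fin.castSucc_lt_castSucc_iff.mpr p.2)))))
    (by
      intro a b j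
      rcases Fin.eq_castSucc_or_eq_last j with ⟨j, rfl⟩ | rfl
      · obtain ⟨L, hL⟩ := f.linear_diag (fun u => a u.castSucc)
          (fun p => b (pos p.1.1.castSucc p.1.2.castSucc
            (Fin.castSucc_lt_castSucc_iff.mpr p.2))) j
        refine ⟨Algebra.lsmul k k M
          (ε (∏ j : Fin n, b (pos j.castSucc (Fin.last n) (Fin.castSucc_lt_last j)))) ∘ₗ
            Algebra.lsmul k k M (MulOpposite.op (a (Fin.last n))) ∘ₗ L, fun x => ?_⟩
        have h : (fun u : Fin n => Function.update a j.castSucc x u.castSucc) =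
            Function.update (fun u : Fin n => a u.castSucc) j x := by
          funext u
          by_cases hu : u = j
          · subst hu; simp
          · simp [hu]
        rw [h, hL, Function.update_of_ne (Fin.castSucc_lt_last j).ne']
        rfl
      · refine ⟨Algebra.lsmul k k M
          (ε (∏ j : Fin n, b (pos j.castSucc (Fin.last n) (Fin.castSucc_lt_last j)))) ∘ₗ
          (LinearMap.toSpanSingleton Aᵐᵒᵖ M (f.eval (fun u => a u.castSucc)
          (fun p => b (pos p.1.1.castSucc p.1.2.castSucc
            (Fin.castSucc_lt_castSucc_iff.mpr p.2))))).restrictScalars k ∘ₗ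
              (MulOpposite.opLinearEquiv k).toLinearMap, fun x => ?_⟩
        have h : ∀ u : Fin n, Function.update a (Fin.last n) x u.castSucc = a u.castSucc :=
          fun u => Function.update_of_ne (Fin.castSucc_lt_last u).ne _ _
        simp only [h]
        simp)
    (by
      intro a b p
      obtain ⟨⟨r, s⟩, hp⟩ := p
      obtain ⟨r, rfl⟩ := Fin.exists_castSucc_eq.mpr (Fin.ne_last_of_lt hp)
      rcases Fin.eq_castSucc_or_eq_last s with ⟨s, rfl⟩ | rfl
      · obtain ⟨L, hL⟩ := f.linear_upper (fun u => a u.castSucc)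
          (fun p => b (pos p.1.1.castSucc p.1.2.castSucc
            (Fin.castSucc_lt_castSucc_iff.mpr p.2)))
          ⟨(r, s), Fin.castSucc_lt_castSucc_iff.mp hp⟩
        refine ⟨Algebra.lsmul k k M
          (ε (∏ j : Fin n, b (pos j.castSucc (Fin.last n) (Fin.castSucc_lt_last j)))) ∘ₗ
            Algebra.lsmul k k M (MulOpposite.op (a (Fin.last n))) ∘ₗ L, fun x => ?_⟩
        have h1 : ∀ j : Fin n, Function.update b ⟨(r.castSucc, s.castSucc), hp⟩ x
            (pos j.castSucc (Fin.last n) (Fin.castSucc_lt_last j)) =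
              b (pos j.castSucc (Fin.last n) (Fin.castSucc_lt_last j)) := by
          intro j
          rw [Function.update_of_ne]
          simp [pos, (Fin.castSucc_lt_last s).ne']
        have h2 : (fun p : Pairs n => Function.update b ⟨(r.castSucc, s.castSucc), hp⟩ x
              (pos p.1.1.castSucc p.1.2.castSucc (Fin.castSucc_lt_castSucc_iff.mpr p.2))) =
            Function.update (fun p : Pairs n =>
              b (pos p.1.1.castSucc p.1.2.castSucc (Fin.castSucc_lt_castSucc_iff.mpr p.2)))
              ⟨(r, s), Fin.castSucc_lt_castSucc_iff.mp hp⟩ x := by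
          funext p
          by_cases hq : p = ⟨(r, s), Fin.castSucc_lt_castSucc_iff.mp hp⟩
          · subst hq; simp [pos]
          · rw [Function.update_of_ne hq, Function.update_of_ne]
            intro h; apply hq
            simp only [pos, Subtype.mk.injEq, Prod.mk.injEq, Fin.castSucc_inj] at h
            exact Subtype.ext (Prod.ext h.1 h.2)
        simp only [h1, h2, hL]
        rfl
      · refine ⟨(LinearMap.toSpanSingleton A M (MulOpposite.op (a (Fin.last n)) •
          f.eval (fun u => a u.castSucc) (fun p => b (pos p.1.1.castSucc p.1.2.castSucc
            (Fin.castSucc_lt_castSucc_iff.mpr p.2))))).restrictScalars k ∘ₗ ε.toLinearMap ∘ₗ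
              (MultilinearMap.mkPiAlgebra k (Fin n) B).toLinearMap
                (fun j : Fin n => b (pos j.castSucc (Fin.last n) (Fin.castSucc_lt_last j))) r,
          fun x => ?_⟩
        have h1 : (fun j : Fin n => Function.update b ⟨(r.castSucc, Fin.last n), hp⟩ x
              (pos j.castSucc (Fin.last n) (Fin.castSucc_lt_last j))) =
            Function.update (fun j : Fin n =>
              b (pos j.castSucc (Fin.last n) (Fin.castSucc_lt_last j))) r x := by
          funext j
          by_cases hj : j = r
          · subst hj; simp
          · rw [Function.update_of_ne hj, Function.update_of_ne]
            simp [pos, hj]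
        have h2 : ∀ p : Pairs n, Function.update b ⟨(r.castSucc, Fin.last n), hp⟩ x
              (pos p.1.1.castSucc p.1.2.castSucc (Fin.castSucc_lt_castSucc_iff.mpr p.2)) =
            b (pos p.1.1.castSucc p.1.2.castSucc (Fin.castSucc_lt_castSucc_iff.mpr p.2)) := by
          intro p
          rw [Function.update_of_ne]
          simp [pos, (Fin.castSucc_lt_last p.1.2).ne]
        simp only [h1, h2]
        simp)

theorem firstTerm_add (ε : B →ₐ[k] A) {n : ℕ} (f g : Cochain k A B M n) :
    firstTerm ε (f + g) = firstTerm ε f + firstTerm ε g := by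
  refine Cochain.ext_eval fun a b => ?_
  simp only [firstTerm, Cochain.eval_ofFun, Cochain.eval_add, smul_add]

theorem lastTerm_add (ε : B →ₐ[k] A) {n : ℕ} (f g : Cochain k A B M n) :
    lastTerm ε (f + g) = lastTerm ε f + lastTerm ε g := by
  refine Cochain.ext_eval fun a b => ?_
  simp only [lastTerm, Cochain.eval_ofFun, Cochain.eval_add, smul_add]

theorem firstTerm_smul (ε : B →ₐ[k] A) {n : ℕ} (r : k) (f : Cochain k A B M n) :
    firstTerm ε (r • f) = r • firstTerm ε f := by
  refine Cochain.ext_eval fun a b => ?_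
  simp only [firstTerm, Cochain.eval_ofFun, Cochain.eval_smul]
  rw [smul_algebra_smul_comm]

theorem lastTerm_smul (ε : B →ₐ[k] A) {n : ℕ} (r : k) (f : Cochain k A B M n) :
    lastTerm ε (r • f) = r • lastTerm ε f := by
  refine Cochain.ext_eval fun a b => ?_
  simp only [lastTerm, Cochain.eval_ofFun, Cochain.eval_smul]
  rw [← smul_algebra_smul_comm, ← smul_algebra_smul_comm]

/-- The differential `δ_n : C^n((A, B, ε); M) → C^{n+1}((A, B, ε); M)`: with rows and columns
numbered from `0`, the product of the rows and columns `i` and `i + 1` comes with the sign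
`(-1)^{i+1}`, for `0 ≤ i < n`. -/
noncomputable def δ (ε : B →ₐ[k] A) (M : Type*) [AddCommGroup M] [Module k M] [Module A M]
    [IsScalarTower k A M] [Module Aᵐᵒᵖ M] [IsScalarTower k Aᵐᵒᵖ M] [SMulCommClass A Aᵐᵒᵖ M]
    (n : ℕ) : Cochain k A B M n →ₗ[k] Cochain k A B M (n + 1) where
  toFun f := firstTerm ε f + ∑ i : Fin n, (-1 : k) ^ ((i : ℕ) + 1) • innerTerm ε i f +
    (-1 : k) ^ (n + 1) • lastTerm ε f
  map_add' f g := by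
    have h : ∀ i : Fin n, innerTerm ε i (f + g) = innerTerm ε i f + innerTerm ε i g := fun i =>
      Cochain.ext_eval fun a b => by simp [innerTerm]
    simp only [firstTerm_add, lastTerm_add, h, smul_add, Finset.sum_add_distrib]
    abel
  map_smul' r f := by
    have h : ∀ i : Fin n, innerTerm ε i (r • f) = r • innerTerm ε i f := fun i =>
      Cochain.ext_eval fun a b => by simp [innerTerm]
    simp only [firstTerm_smul, lastTerm_smul, h, smul_add, Finset.smul_sum, smul_comm _ r,
      RingHom.id_apply]

/-- The cocycles `Z^n((A, B, ε); M) = ker δ_n`. -/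
noncomputable def cocycles (ε : B →ₐ[k] A) (M : Type*) [AddCommGroup M] [Module k M] [Module A M]
    [IsScalarTower k A M] [Module Aᵐᵒᵖ M] [IsScalarTower k Aᵐᵒᵖ M] [SMulCommClass A Aᵐᵒᵖ M]
    (n : ℕ) : Submodule k (Cochain k A B M n) :=
  LinearMap.ker (δ ε M n)

/-- The coboundaries: the image of `δ_{n-1}`, and `0` in degree `0`. -/
noncomputable def coboundaries (ε : B →ₐ[k] A) (M : Type*) [AddCommGroup M] [Module k M] [Module A M]
    [IsScalarTower k A M] [Module Aᵐᵒᵖ M] [IsScalarTower k Aᵐᵒᵖ M] [SMulCommClass A Aᵐᵒᵖ M] :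
    (n : ℕ) → Submodule k (Cochain k A B M n)
  | 0 => ⊥
  | n + 1 => LinearMap.range (δ ε M n)

/-- The secondary cohomology `H^n((A, B, ε); M)`, cocycles modulo coboundaries. -/
noncomputable abbrev Cohomology (ε : B →ₐ[k] A) (M : Type*) [AddCommGroup M] [Module k M] [Module A M]
    [IsScalarTower k A M] [Module Aᵐᵒᵖ M] [IsScalarTower k Aᵐᵒᵖ M] [SMulCommClass A Aᵐᵒᵖ M]
    (n : ℕ) : Type _ :=
  cocycles ε M n ⧸ (coboundaries ε M n).submoduleOf (cocycles ε M n)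

/-- The class of a cocycle in `H^n((A, B, ε); M)`. -/
noncomputable def cohomologyClass (ε : B →ₐ[k] A) (M : Type*) [AddCommGroup M] [Module k M] [Module A M]
    [IsScalarTower k A M] [Module Aᵐᵒᵖ M] [IsScalarTower k Aᵐᵒᵖ M] [SMulCommClass A Aᵐᵒᵖ M]
    {n : ℕ} (z : cocycles ε M n) : Cohomology ε M n :=
  Submodule.Quotient.mk z

end Complex

section Families

variable {k A B : Type*} [Field k] [Ring A] [Algebra k A] [CommRing B] [Algebra k B]

/-- The value `f(a ⊗ b ⊗ α)` of `f : A ⊗ A ⊗ B → A`, a cochain of degree `2`. -/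
noncomputable def ev (f : Cochain k A B A 2) (a b : A) (α : B) : A :=
  f.eval ![a, b] (fun _ => α)

theorem ev_linear_fst (f : Cochain k A B A 2) (b : A) (α : B) :
    ∃ L : A →ₗ[k] A, ∀ x, ev f x b α = L x := by
  obtain ⟨L, hL⟩ := f.linear_diag ![0, b] (fun _ => α) 0
  refine ⟨L, fun x => ?_⟩
  rw [← hL, ev]
  congr 2
  ext i; fin_cases i <;> rfl

theorem ev_linear_snd (f : Cochain k A B A 2) (a : A) (α : B) :
    ∃ L : A →ₗ[k] A, ∀ x, ev f a x α = L x := by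
  obtain ⟨L, hL⟩ := f.linear_diag ![a, 0] (fun _ => α) 1
  refine ⟨L, fun x => ?_⟩
  rw [← hL, ev]
  congr 2
  ext i; fin_cases i <;> rfl

theorem ev_linear_thd (f : Cochain k A B A 2) (a b : A) :
    ∃ L : B →ₗ[k] A, ∀ x, ev f a b x = L x := by
  obtain ⟨L, hL⟩ := f.linear_upper ![a, b] (fun _ => 0) (pos 0 1 (by decide))
  refine ⟨L, fun x => ?_⟩
  rw [← hL, ev]
  congr 1
  ext p
  have : p = pos 0 1 (by decide) := by revert p; decide
  subst this
  simp

/-- `(f ∘̄ g)(a, b, c; α, β, γ) = f(g(a ⊗ b ⊗ α) ⊗ c ⊗ βγ) - f(a ⊗ g(b ⊗ c ⊗ γ) ⊗ αβ)`, where `α`,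
`β`, `γ` are the entries at the positions `(0, 1)`, `(0, 2)`, `(1, 2)`. -/
noncomputable def circ (f g : Cochain k A B A 2) : Cochain k A B A 3 :=
  Cochain.ofFun
    (fun a b =>
      ev f (ev g (a 0) (a 1) (b (pos 0 1 (by decide)))) (a 2)
        (b (pos 0 2 (by decide)) * b (pos 1 2 (by decide))) -
      ev f (a 0) (ev g (a 1) (a 2) (b (pos 1 2 (by decide))))
        (b (pos 0 1 (by decide)) * b (pos 0 2 (by decide))))
    (by
      intro a b j
      fin_cases j
      · obtain ⟨L₁, h₁⟩ := ev_linear_fst g (a 1) (b (pos 0 1 (by decide)))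
        obtain ⟨L₂, h₂⟩ := ev_linear_fst f (a 2)
          (b (pos 0 2 (by decide)) * b (pos 1 2 (by decide)))
        obtain ⟨L₃, h₃⟩ := ev_linear_fst f (ev g (a 1) (a 2) (b (pos 1 2 (by decide))))
          (b (pos 0 1 (by decide)) * b (pos 0 2 (by decide)))
        exact ⟨L₂ ∘ₗ L₁ - L₃, fun x => by simp [h₁, h₂, h₃]⟩
      · obtain ⟨L₁, h₁⟩ := ev_linear_snd g (a 0) (b (pos 0 1 (by decide)))
        obtain ⟨L₂, h₂⟩ := ev_linear_fst f (a 2)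
          (b (pos 0 2 (by decide)) * b (pos 1 2 (by decide)))
        obtain ⟨L₃, h₃⟩ := ev_linear_fst g (a 2) (b (pos 1 2 (by decide)))
        obtain ⟨L₄, h₄⟩ := ev_linear_snd f (a 0)
          (b (pos 0 1 (by decide)) * b (pos 0 2 (by decide)))
        exact ⟨L₂ ∘ₗ L₁ - L₄ ∘ₗ L₃, fun x => by simp [h₁, h₂, h₃, h₄]⟩
      · obtain ⟨L₂, h₂⟩ := ev_linear_snd f (ev g (a 0) (a 1) (b (pos 0 1 (by decide))))
          (b (pos 0 2 (by decide)) * b (pos 1 2 (by decide)))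
        obtain ⟨L₃, h₃⟩ := ev_linear_snd g (a 1) (b (pos 1 2 (by decide)))
        obtain ⟨L₄, h₄⟩ := ev_linear_snd f (a 0)
          (b (pos 0 1 (by decide)) * b (pos 0 2 (by decide)))
        exact ⟨L₂ - L₄ ∘ₗ L₃, fun x => by simp [h₂, h₃, h₄]⟩)
    (by
      intro a b p
      have hp : p = pos 0 1 (by decide) ∨ p = pos 0 2 (by decide) ∨ p = pos 1 2 (by decide) := by
        revert p; decide
      rcases hp with rfl | rfl | rfl
      · obtain ⟨L₁, h₁⟩ := ev_linear_thd g (a 0) (a 1)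
        obtain ⟨L₂, h₂⟩ := ev_linear_fst f (a 2)
          (b (pos 0 2 (by decide)) * b (pos 1 2 (by decide)))
        obtain ⟨L₄, h₄⟩ := ev_linear_thd f (a 0) (ev g (a 1) (a 2) (b (pos 1 2 (by decide))))
        exact ⟨L₂ ∘ₗ L₁ - L₄ ∘ₗ LinearMap.mulRight k (b (pos 0 2 (by decide))),
          fun x => by simp [h₁, h₂, h₄]⟩
      · obtain ⟨L₂, h₂⟩ := ev_linear_thd f (ev g (a 0) (a 1) (b (pos 0 1 (by decide)))) (a 2)
        obtain ⟨L₄, h₄⟩ := ev_linear_thd f (a 0) (ev g (a 1) (a 2) (b (pos 1 2 (by decide))))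
        exact ⟨L₂ ∘ₗ LinearMap.mulRight k (b (pos 1 2 (by decide))) -
          L₄ ∘ₗ LinearMap.mulLeft k (b (pos 0 1 (by decide))), fun x => by simp [h₂, h₄]⟩
      · obtain ⟨L₂, h₂⟩ := ev_linear_thd f (ev g (a 0) (a 1) (b (pos 0 1 (by decide)))) (a 2)
        obtain ⟨L₃, h₃⟩ := ev_linear_thd g (a 1) (a 2)
        obtain ⟨L₄, h₄⟩ := ev_linear_snd f (a 0)
          (b (pos 0 1 (by decide)) * b (pos 0 2 (by decide)))
        exact ⟨L₂ ∘ₗ LinearMap.mulLeft k (b (pos 0 2 (by decide))) - L₄ ∘ₗ L₃,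
          fun x => by simp [h₂, h₃, h₄]⟩)

/-- `c_1 ∘̄ c_n + c_2 ∘̄ c_{n-1} + ⋯ + c_n ∘̄ c_1`. -/
noncomputable def obstruction (c : ℕ → Cochain k A B A 2) (n : ℕ) : Cochain k A B A 3 :=
  ∑ p ∈ Finset.Icc 1 n, circ (c p) (c (n + 1 - p))

/-- The coefficients of the family: `ε(α)ab` in degree `0` and `c_i(a ⊗ b ⊗ α)` in degree `i ≥ 1`.
The value `c 0` is not used. -/
noncomputable def famCoeff (ε : B →ₐ[k] A) (c : ℕ → Cochain k A B A 2) (i : ℕ) (α : B) :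
    A →ₗ[k] A →ₗ[k] A :=
  LinearMap.mk₂ k (fun a b => if i = 0 then ε α * (a * b) else ev (c i) a b α)
    (fun x y b => by
      obtain ⟨L, hL⟩ := ev_linear_fst (c i) b α
      split_ifs <;> simp [hL, add_mul, mul_add])
    (fun r x b => by
      obtain ⟨L, hL⟩ := ev_linear_fst (c i) b α
      split_ifs <;> simp [hL])
    (fun a x y => by
      obtain ⟨L, hL⟩ := ev_linear_snd (c i) a α
      split_ifs <;> simp [hL, mul_add])
    (fun r a x => by
      obtain ⟨L, hL⟩ := ev_linear_snd (c i) a α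
      split_ifs <;> simp [hL])

/-- The product `m_{α,t}` on `A[[t]]`, the `t`-bilinear extension of
`a ⊗ b ↦ ε(α)ab + ∑_{i ≥ 1} c_i(a ⊗ b ⊗ α) t^i`: the coefficient of `t^N` in the product of
`∑ x_u t^u` and `∑ y_v t^v` is the sum over `i + u + v = N` of the `i`-th coefficient of the family
at `x_u ⊗ y_v ⊗ α`. -/
noncomputable def famProd (ε : B →ₐ[k] A) (c : ℕ → Cochain k A B A 2) (α : B) :
    A⟦X⟧ →ₗ[k] A⟦X⟧ →ₗ[k] A⟦X⟧ :=
  LinearMap.mk₂ k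
    (fun x y => PowerSeries.mk fun N =>
      ∑ p ∈ Finset.HasAntidiagonal.antidiagonal N, ∑ q ∈ Finset.HasAntidiagonal.antidiagonal p.2,
        famCoeff ε c p.1 α (PowerSeries.coeff q.1 x) (PowerSeries.coeff q.2 y))
    (fun x y z => by ext N; simp [Finset.sum_add_distrib])
    (fun r x z => by ext N; simp [Finset.smul_sum])
    (fun x y z => by ext N; simp [Finset.sum_add_distrib])
    (fun r x z => by ext N; simp [Finset.smul_sum])

/-- The family is associative mod `t^N`:
`m_{αβ,t}(id ⊗ m_{γ,t}) = m_{βγ,t}(m_{α,t} ⊗ id)` modulo `t^N`. -/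
def IsAssocMod (ε : B →ₐ[k] A) (c : ℕ → Cochain k A B A 2) (N : ℕ) : Prop :=
  ∀ (α β γ : B) (x y z : A⟦X⟧), ∀ i < N,
    PowerSeries.coeff i (famProd ε c (α * β) x (famProd ε c γ y z)) =
      PowerSeries.coeff i (famProd ε c (β * γ) (famProd ε c α x y) z)

/-- The families given by `c` and `d` are isomorphic: there is a `k[[t]]`-linear bijection `φ` of
`A[[t]]` of the form `φ(a) = a + f_1(a)t + f_2(a)t^2 + ⋯` for `a ∈ A` that carries each product of
the first family to the product of the second with the same index. -/
def IsIsomorphic (ε : B →ₐ[k] A) (c d : ℕ → Cochain k A B A 2) : Prop :=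
  ∃ φ : A⟦X⟧ ≃ₗ[k] A⟦X⟧,
    (∀ (r : k⟦X⟧) (x : A⟦X⟧),
      φ (PowerSeries.map (algebraMap k A) r * x) = PowerSeries.map (algebraMap k A) r * φ x) ∧
    (∀ a : A, PowerSeries.constantCoeff (φ (PowerSeries.C a)) = a) ∧
    ∀ (α : B) (x y : A⟦X⟧), φ (famProd ε c α x y) = famProd ε d α (φ x) (φ y)

end Families

end SecondaryHochschild

/-! Everything is read off from the associator of the family, `m_{βγ}(m_α(x ⊗ y) ⊗ z) - m_{αβ}(x ⊗
m_γ(y ⊗ z))`. It is additive and `t`-linear in each argument, so once it vanishes mod `t^N` for all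
arguments, its coefficient at `t^N` depends only on the constant coefficients of the arguments
(`coeff_associator_eq_constantCoeff`). On constants, the coefficient at `t^(N+1)` is `Ω_N - δ
c_{N+1}`, where `Ω_N` is the obstruction (`coeff_succ_associator_C`). Hence associativity mod
`t^(N+1)` is the system of equations `δ c_{i+1} = Ω_i` for `i < N` (`isAssocMod_iff`). As `Ω_0 = 0`,
this gives the criterion mod `t^2`; passing from `t^(n+1)` to `t^(n+2)` adds the single equation `δ
c_{n+1} = Ω_n`, solvable exactly when `Ω_n` is a coboundary.

That `Ω_n` is a cocycle follows from the pentagon: five associators on four arguments sum, with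
signs, to zero for any family of bilinear products indexed by `B` (`associator_pentagon`). If all
associators vanish mod `t^(n+1)` and `c_{n+1} = 0`, the coefficient of this identity at `t^(n+1)` is
`δ Ω_n = 0`.

For an isomorphism `φ = id + f t + ⋯`, comparing the coefficients of `t` gives `δ f = c_1 - d_1`;
then `δδ = 0` makes `d_1` a cocycle as well. -/

namespace SecondaryHochschild

/-! ### Cochains and differentials in degrees one to three -/

section LowDegrees

variable {k A B : Type*} [Field k] [Ring A] [Algebra k A] [CommRing B] [Algebra k B]

/-- The value `f(a)` of a cochain of degree `1`. -/
noncomputable def evOne (f : Cochain k A B A 1) (a : A) : A := f.eval ![a] (fun _ => 1)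

/-- The value of a cochain of degree `3` on the matrix with diagonal `a`, `b`, `c` and entries
`α`, `β`, `γ` at the positions `(0, 1)`, `(0, 2)`, `(1, 2)`. -/
noncomputable def evThree (f : Cochain k A B A 3) (a b c : A) (α β γ : B) : A :=
  f.eval ![a, b, c] (fun p => if p.1.1 = 1 then γ else if p.1.2 = 1 then α else β)

theorem eval_one (f : Cochain k A B A 1) (a : Fin 1 → A) (b : Pairs 1 → B) :
    f.eval a b = evOne f (a 0) := by
  rw [evOne]
  congr 1
  · ext i; fin_cases i; rfl
  -- There is no position above the diagonal of a `1 × 1` matrix, so the filler `1` in `evOne` is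
  -- never read.
  · ext ⟨⟨u, v⟩, h⟩; omega

theorem eval_two (f : Cochain k A B A 2) (a : Fin 2 → A) (b : Pairs 2 → B) :
    f.eval a b = ev f (a 0) (a 1) (b (pos 0 1 (by decide))) := by
  rw [ev]
  congr 1
  · ext i; fin_cases i <;> rfl
  · ext p
    have : p = pos 0 1 (by decide) := by revert p; decide
    rw [this]

theorem eval_three (f : Cochain k A B A 3) (a : Fin 3 → A) (b : Pairs 3 → B) :
    f.eval a b = evThree f (a 0) (a 1) (a 2) (b (pos 0 1 (by decide)))
      (b (pos 0 2 (by decide))) (b (pos 1 2 (by decide))) := by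
  rw [evThree]
  congr 1
  · ext i; fin_cases i <;> rfl
  · ext p
    have hp : p = pos 0 1 (by decide) ∨ p = pos 0 2 (by decide) ∨ p = pos 1 2 (by decide) := by
      revert p; decide
    rcases hp with rfl | rfl | rfl <;> simp

theorem ext_ev {f g : Cochain k A B A 2} (h : ∀ a b α, ev f a b α = ev g a b α) : f = g :=
  Cochain.ext_eval fun a b => by rw [eval_two, eval_two, h]

theorem ext_evThree {f g : Cochain k A B A 3}
    (h : ∀ a b c α β γ, evThree f a b c α β γ = evThree g a b c α β γ) : f = g :=
  Cochain.ext_eval fun a b => by rw [eval_three, eval_three, h]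

theorem Cochain.eval_sub {n : ℕ} (f g : Cochain k A B A n) (a : Fin n → A) (b : Pairs n → B) :
    (f - g).eval a b = f.eval a b - g.eval a b := rfl

theorem Cochain.eval_zero {n : ℕ} (a : Fin n → A) (b : Pairs n → B) :
    (0 : Cochain k A B A n).eval a b = 0 := rfl

theorem Cochain.eval_sum {n : ℕ} {ι : Type*} (s : Finset ι) (f : ι → Cochain k A B A n)
    (a : Fin n → A) (b : Pairs n → B) :
    (∑ i ∈ s, f i).eval a b = ∑ i ∈ s, (f i).eval a b := by
  simp [Cochain.eval, LinearMap.sum_apply]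

theorem delta_eval (ε : B →ₐ[k] A) {n : ℕ} (f : Cochain k A B A n)
    (a : Fin (n + 1) → A) (b : Pairs (n + 1) → B) :
    (δ ε A n f).eval a b =
      a 0 * ε (∏ j : Fin n, b (pos 0 j.succ (Fin.succ_pos j))) *
        f.eval (fun u => a u.succ)
          (fun p => b (pos p.1.1.succ p.1.2.succ (Fin.succ_lt_succ_iff.mpr p.2))) +
      ∑ i : Fin n, (-1 : k) ^ ((i : ℕ) + 1) • f.eval (faceDiag ε i a b) (faceUpper i b) +
      (-1 : k) ^ (n + 1) •
        (ε (∏ j : Fin n, b (pos j.castSucc (Fin.last n) (Fin.castSucc_lt_last j))) *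
          (f.eval (fun u => a u.castSucc)
            (fun p => b (pos p.1.1.castSucc p.1.2.castSucc
              (Fin.castSucc_lt_castSucc_iff.mpr p.2))) * a (Fin.last n))) := by
  change (firstTerm ε f + ∑ i : Fin n, (-1 : k) ^ ((i : ℕ) + 1) • innerTerm ε i f +
    (-1 : k) ^ (n + 1) • lastTerm ε f).eval a b = _
  rw [Cochain.eval_add, Cochain.eval_add, Cochain.eval_sum]
  simp only [Cochain.eval_smul, firstTerm, lastTerm, innerTerm, Cochain.eval_ofFun, smul_eq_mul,
    MulOpposite.smul_eq_mul_unop, MulOpposite.unop_op]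

theorem ev_delta (ε : B →ₐ[k] A) (f : Cochain k A B A 1) (a b : A) (α : B) :
    ev (δ ε A 1 f) a b α =
      a * ε α * evOne f b - evOne f (ε α * (a * b)) + ε α * (evOne f a * b) := by
  rw [ev, delta_eval]
  simp [eval_one, faceDiag, lo, hi, sub_eq_add_neg]

theorem evThree_delta (ε : B →ₐ[k] A) (f : Cochain k A B A 2) (a b c : A) (α β γ : B) :
    evThree (δ ε A 2 f) a b c α β γ =
      a * ε (α * β) * ev f b c γ - ev f (ε α * (a * b)) c (β * γ)
        + ev f a (ε γ * (b * c)) (α * β) - ε (β * γ) * (ev f a b α * c) := by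
  have h3 : (-1 : k) ^ 3 = -1 := by ring
  rw [evThree, delta_eval]
  simp [eval_two, faceDiag, faceUpper, lo, hi, sub_eq_add_neg, Fin.sum_univ_succ,
    Fin.prod_univ_succ, Fin.succAbove, h3, add_assoc, mul_assoc]

/-- The five terms have the same order, signs and parameters as those of `associator_pentagon`,
which is what lets the cocycle condition be read off from the pentagon. -/
theorem eval_delta_three (ε : B →ₐ[k] A) (f : Cochain k A B A 3) (a : Fin 4 → A)
    (b : Pairs 4 → B) :
    (δ ε A 3 f).eval a b =
      a 0 * ε (b (pos 0 1 (by decide)) * b (pos 0 2 (by decide)) * b (pos 0 3 (by decide))) *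
        evThree f (a 1) (a 2) (a 3) (b (pos 1 2 (by decide))) (b (pos 1 3 (by decide)))
          (b (pos 2 3 (by decide)))
      - evThree f (ε (b (pos 0 1 (by decide))) * (a 0 * a 1)) (a 2) (a 3)
          (b (pos 0 2 (by decide)) * b (pos 1 2 (by decide)))
          (b (pos 0 3 (by decide)) * b (pos 1 3 (by decide))) (b (pos 2 3 (by decide)))
      + evThree f (a 0) (ε (b (pos 1 2 (by decide))) * (a 1 * a 2)) (a 3)
          (b (pos 0 1 (by decide)) * b (pos 0 2 (by decide))) (b (pos 0 3 (by decide)))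
          (b (pos 1 3 (by decide)) * b (pos 2 3 (by decide)))
      - evThree f (a 0) (a 1) (ε (b (pos 2 3 (by decide))) * (a 2 * a 3))
          (b (pos 0 1 (by decide))) (b (pos 0 2 (by decide)) * b (pos 0 3 (by decide)))
          (b (pos 1 2 (by decide)) * b (pos 1 3 (by decide)))
      + ε (b (pos 0 3 (by decide)) * b (pos 1 3 (by decide)) * b (pos 2 3 (by decide))) *
        (evThree f (a 0) (a 1) (a 2) (b (pos 0 1 (by decide))) (b (pos 0 2 (by decide)))
          (b (pos 1 2 (by decide))) * a 3) := by
  have h3 : (-1 : k) ^ 3 = -1 := by ring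
  have h4 : (-1 : k) ^ 4 = 1 := by ring
  rw [delta_eval]
  simp [eval_three, faceDiag, faceUpper, lo, hi, sub_eq_add_neg, Fin.sum_univ_succ,
    Fin.prod_univ_succ, Fin.succAbove, h3, h4, add_assoc, mul_assoc]

theorem evThree_circ (f g : Cochain k A B A 2) (a b c : A) (α β γ : B) :
    evThree (circ f g) a b c α β γ =
      ev f (ev g a b α) c (β * γ) - ev f a (ev g b c γ) (α * β) := by
  simp [evThree, circ]

/-- The only instance of `δδ = 0` that is needed. Centrality moves every `ε` to the left,
multiplicativity merges them, and the terms then cancel in pairs. -/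
theorem delta_delta_one (ε : B →ₐ[k] A) (hε : ∀ β : B, ε β ∈ Subalgebra.center k A)
    (f : Cochain k A B A 1) : δ ε A 2 (δ ε A 1 f) = 0 := by
  refine ext_evThree fun a b c α β γ => ?_
  have hc : ∀ x β, x * ε β = ε β * x := fun x β => Subalgebra.mem_center_iff.mp (hε β) x
  have hl : ∀ x β y, x * (ε β * y) = ε β * (x * y) := fun x β y => by
    rw [← mul_assoc, hc, mul_assoc]
  have hb : ∀ β γ x, ε β * (ε γ * x) = ε (β * γ) * x := fun β γ x => by
    rw [map_mul, mul_assoc]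
  rw [evThree_delta, evThree, Cochain.eval_zero]
  simp only [ev_delta, mul_assoc, hc a, hc b, hl a, hl (evOne f a), hb, mul_sub, mul_add,
    sub_mul, add_mul]
  simp only [mul_comm (G := B), mul_left_comm (G := B)]
  abel

end LowDegrees

end SecondaryHochschild

namespace SecondaryHochschild

section Associators

open PowerSeries Finset

variable {k A B : Type*} [Field k] [Ring A] [Algebra k A] [CommRing B] [Algebra k B]

/-! ### Coefficients of the products on `A[[t]]` -/

theorem famCoeff_zero (ε : B →ₐ[k] A) (c : ℕ → Cochain k A B A 2) (α : B) (a b : A) :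
    famCoeff ε c 0 α a b = ε α * (a * b) := by simp [famCoeff]

theorem famCoeff_succ (ε : B →ₐ[k] A) (c : ℕ → Cochain k A B A 2) (i : ℕ) (α : B) (a b : A) :
    famCoeff ε c (i + 1) α a b = ev (c (i + 1)) a b α := by simp [famCoeff]

theorem coeff_famProd (ε : B →ₐ[k] A) (c : ℕ → Cochain k A B A 2) (α : B) (x y : A⟦X⟧) (N : ℕ) :
    coeff N (famProd ε c α x y) = ∑ p ∈ antidiagonal N, ∑ q ∈ antidiagonal p.2,
      famCoeff ε c p.1 α (coeff q.1 x) (coeff q.2 y) := by simp [famProd]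

theorem coeff_zero_famProd (ε : B →ₐ[k] A) (c : ℕ → Cochain k A B A 2) (α : B) (x y : A⟦X⟧) :
    coeff 0 (famProd ε c α x y) = ε α * (coeff 0 x * coeff 0 y) := by
  simp [coeff_famProd, famCoeff_zero]

theorem coeff_one_famProd (ε : B →ₐ[k] A) (c : ℕ → Cochain k A B A 2) (α : B) (x y : A⟦X⟧) :
    coeff 1 (famProd ε c α x y) =
      ε α * (coeff 0 x * coeff 1 y) + ε α * (coeff 1 x * coeff 0 y) +
        ev (c 1) (coeff 0 x) (coeff 0 y) α := by
  have h : antidiagonal 1 = {((0 : ℕ), 1), (1, 0)} := rfl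
  simp only [coeff_famProd, h]
  rw [sum_pair (by decide)]
  simp only [h, Nat.antidiagonal_zero]
  rw [sum_pair (by decide)]
  simp [famCoeff_zero, famCoeff_succ ε c 0]

/-- Linearity in `X` is all that is used of `t`-bilinearity: a series is its constant coefficient
plus `X` times another series. -/
theorem famProd_X_mul_left (ε : B →ₐ[k] A) (c : ℕ → Cochain k A B A 2) (α : B) (x y : A⟦X⟧) :
    famProd ε c α (X * x) y = X * famProd ε c α x y := by
  ext N
  cases N with
  | zero => simp [coeff_zero_famProd]
  | succ N =>
    rw [coeff_succ_X_mul, coeff_famProd, coeff_famProd, Nat.sum_antidiagonal_succ']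
    simp [Nat.sum_antidiagonal_succ, coeff_succ_X_mul]

theorem famProd_X_mul_right (ε : B →ₐ[k] A) (c : ℕ → Cochain k A B A 2) (α : B) (x y : A⟦X⟧) :
    famProd ε c α x (X * y) = X * famProd ε c α x y := by
  ext N
  cases N with
  | zero => simp [coeff_zero_famProd]
  | succ N =>
    rw [coeff_succ_X_mul, coeff_famProd, coeff_famProd, Nat.sum_antidiagonal_succ']
    simp [Nat.sum_antidiagonal_succ', coeff_succ_X_mul]

theorem coeff_famProd_C_left (ε : B →ₐ[k] A) (c : ℕ → Cochain k A B A 2) (α : B) (a : A)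
    (y : A⟦X⟧) (N : ℕ) :
    coeff N (famProd ε c α (C a) y) =
      ∑ p ∈ antidiagonal N, famCoeff ε c p.1 α a (coeff p.2 y) := by
  rw [coeff_famProd]
  refine sum_congr rfl fun p _ => ?_
  rw [sum_eq_single (0, p.2)]
  · simp
  · rintro ⟨u, v⟩ h h'
    have : u ≠ 0 := by
      rintro rfl
      simp at h
      exact h' (by rw [h])
    simp [coeff_C, this]
  · simp

theorem coeff_famProd_C_right (ε : B →ₐ[k] A) (c : ℕ → Cochain k A B A 2) (α : B) (x : A⟦X⟧)
    (b : A) (N : ℕ) :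
    coeff N (famProd ε c α x (C b)) =
      ∑ p ∈ antidiagonal N, famCoeff ε c p.1 α (coeff p.2 x) b := by
  rw [coeff_famProd]
  refine sum_congr rfl fun p _ => ?_
  rw [sum_eq_single (p.2, 0)]
  · simp
  · rintro ⟨u, v⟩ h h'
    have : v ≠ 0 := by
      rintro rfl
      simp at h
      exact h' (by rw [h])
    simp [coeff_C, this]
  · simp

theorem coeff_famProd_C_C (ε : B →ₐ[k] A) (c : ℕ → Cochain k A B A 2) (α : B) (a b : A) (N : ℕ) :
    coeff N (famProd ε c α (C a) (C b)) = famCoeff ε c N α a b := by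
  rw [coeff_famProd_C_left, sum_eq_single (N, 0)]
  · simp
  · rintro ⟨u, v⟩ h h'
    have : v ≠ 0 := by
      rintro rfl
      simp at h
      exact h' (by rw [h])
    simp [coeff_C, this]
  · simp

/-! ### Associators and the equations `δ c_{i+1} = Ω_i` -/

/-- The associator `m_{βγ,t}(m_{α,t}(x ⊗ y) ⊗ z) - m_{αβ,t}(x ⊗ m_{γ,t}(y ⊗ z))`. -/
noncomputable def associator (ε : B →ₐ[k] A) (c : ℕ → Cochain k A B A 2) (α β γ : B)
    (x y z : A⟦X⟧) : A⟦X⟧ :=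
  famProd ε c (β * γ) (famProd ε c α x y) z - famProd ε c (α * β) x (famProd ε c γ y z)

theorem isAssocMod_iff_coeff_associator (ε : B →ₐ[k] A) (c : ℕ → Cochain k A B A 2) (N : ℕ) :
    IsAssocMod ε c N ↔
      ∀ i < N, ∀ α β γ x y z, coeff i (associator ε c α β γ x y z) = 0 := by
  simp only [IsAssocMod, associator, map_sub, sub_eq_zero]
  exact ⟨fun h i hi α β γ x y z => (h α β γ x y z i hi).symm,
    fun h α β γ x y z i hi => (h i hi α β γ x y z).symm⟩

/-- If all associators vanish modulo `t^N`, then their coefficients at `t^N` only depend on the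
constant coefficients of the arguments. -/
theorem coeff_associator_eq_constantCoeff (ε : B →ₐ[k] A) (c : ℕ → Cochain k A B A 2) {N : ℕ}
    (h : ∀ i < N, ∀ α β γ x y z, coeff i (associator ε c α β γ x y z) = 0)
    (α β γ : B) (x y z : A⟦X⟧) :
    coeff N (associator ε c α β γ x y z) =
      coeff N (associator ε c α β γ (C (coeff 0 x)) (C (coeff 0 y)) (C (coeff 0 z))) := by
  -- Multiplication by `X` turns the coefficient at `N` into the one at `N - 1`, zero by hypothesis.
  -- Replacing an argument by its constant coefficient changes the associator by such a multiple, so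
  -- the arguments can be replaced one at a time.
  have hX : ∀ w : A⟦X⟧, (∃ x y z, w = associator ε c α β γ x y z) → coeff N (X * w) = 0 := by
    rintro w ⟨x, y, z, rfl⟩
    cases N with
    | zero => simp
    | succ N => rw [coeff_succ_X_mul]; exact h N (Nat.lt_succ_self N) α β γ x y z
  have hd : ∀ w : A⟦X⟧, ∃ w', w = X * w' + C (coeff 0 w) := fun w =>
    ⟨_, by
    rw [coeff_zero_eq_constantCoeff_apply]; exact eq_X_mul_shift_add_const w⟩
  have h1 : ∀ x y z, coeff N (associator ε c α β γ x y z) =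
      coeff N (associator ε c α β γ (C (coeff 0 x)) y z) := by
    intro x y z
    obtain ⟨x', hx⟩ := hd x
    have : associator ε c α β γ x y z =
        X * associator ε c α β γ x' y z + associator ε c α β γ (C (coeff 0 x)) y z := by
      conv_lhs => rw [hx]
      simp only [associator, map_add, LinearMap.add_apply, famProd_X_mul_left, mul_sub]
      abel
    rw [this, map_add, hX _ ⟨_, _, _, rfl⟩, zero_add]
  have h2 : ∀ x y z, coeff N (associator ε c α β γ x y z) =
      coeff N (associator ε c α β γ x (C (coeff 0 y)) z) := by
    intro x y z
    obtain ⟨y', hy⟩ := hd y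
    have : associator ε c α β γ x y z =
        X * associator ε c α β γ x y' z + associator ε c α β γ x (C (coeff 0 y)) z := by
      conv_lhs => rw [hy]
      simp only [associator, map_add, LinearMap.add_apply, famProd_X_mul_left,
        famProd_X_mul_right, mul_sub]
      abel
    rw [this, map_add, hX _ ⟨_, _, _, rfl⟩, zero_add]
  have h3 : ∀ x y z, coeff N (associator ε c α β γ x y z) =
      coeff N (associator ε c α β γ x y (C (coeff 0 z))) := by
    intro x y z
    obtain ⟨z', hz⟩ := hd z
    have : associator ε c α β γ x y z =
        X * associator ε c α β γ x y z' + associator ε c α β γ x y (C (coeff 0 z)) := by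
      conv_lhs => rw [hz]
      simp only [associator, map_add, famProd_X_mul_right, mul_sub]
      abel
    rw [this, map_add, hX _ ⟨_, _, _, rfl⟩, zero_add]
  rw [h1, h2, h3]

theorem coeff_associator_C (ε : B →ₐ[k] A) (c : ℕ → Cochain k A B A 2) (N : ℕ) (α β γ : B)
    (x y z : A) :
    coeff N (associator ε c α β γ (C x) (C y) (C z)) =
      ∑ p ∈ antidiagonal N, (famCoeff ε c p.1 (β * γ) (famCoeff ε c p.2 α x y) z -
        famCoeff ε c p.1 (α * β) x (famCoeff ε c p.2 γ y z)) := by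
  rw [associator, map_sub, coeff_famProd_C_right, coeff_famProd_C_left, sum_sub_distrib]
  simp only [coeff_famProd_C_C]

/-- Since `ε` is multiplicative with central image, both bracketings have constant coefficient
`ε(αβγ)` times the product of the three constant coefficients. -/
theorem coeff_zero_associator (ε : B →ₐ[k] A) (hε : ∀ β : B, ε β ∈ Subalgebra.center k A)
    (c : ℕ → Cochain k A B A 2) (α β γ : B) (x y z : A⟦X⟧) :
    coeff 0 (associator ε c α β γ x y z) = 0 := by
  have hl : ∀ x β y, x * (ε β * y) = ε β * (x * y) := fun x β y => by
    rw [← mul_assoc, Subalgebra.mem_center_iff.mp (hε β) x, mul_assoc]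
  simp only [associator, map_sub, coeff_zero_famProd, map_mul, mul_assoc]
  rw [hl (coeff 0 x), hl (ε γ) α, hl (ε β) α, sub_self]

theorem evThree_obstruction (c : ℕ → Cochain k A B A 2) (n : ℕ) (x y z : A) (α β γ : B) :
    evThree (obstruction c n) x y z α β γ =
      ∑ p ∈ Icc 1 n, (ev (c p) (ev (c (n + 1 - p)) x y α) z (β * γ) -
        ev (c p) x (ev (c (n + 1 - p)) y z γ) (α * β)) := by
  rw [evThree, obstruction, Cochain.eval_sum]
  exact sum_congr rfl fun _ _ => evThree_circ ..

/-- The two extreme summands, where one of the two products is undeformed, contain `c_{N+1}` and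
make up `-δ c_{N+1}`; the remaining ones are the obstruction. -/
theorem coeff_succ_associator_C (ε : B →ₐ[k] A) (hε : ∀ β : B, ε β ∈ Subalgebra.center k A)
    (c : ℕ → Cochain k A B A 2) (N : ℕ) (α β γ : B) (x y z : A) :
    coeff (N + 1) (associator ε c α β γ (C x) (C y) (C z)) =
      evThree (obstruction c N - δ ε A 2 (c (N + 1))) x y z α β γ := by
  have hc : ∀ x β, x * ε β = ε β * x := fun x β => Subalgebra.mem_center_iff.mp (hε β) x
  have hI : Icc 1 N = Ico 1 (N + 1) := by ext; simp
  rw [evThree, Cochain.eval_sub, ← evThree, ← evThree, evThree_delta, evThree_obstruction,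
    coeff_associator_C, Nat.sum_antidiagonal_eq_sum_range_succ_mk,
    sum_range_succ, sum_range_succ', hI, sum_Ico_eq_sum_range]
  have : ∀ p ∈ range N, famCoeff ε c (p + 1) (β * γ) (famCoeff ε c (N + 1 - (p + 1)) α x y) z -
        famCoeff ε c (p + 1) (α * β) x (famCoeff ε c (N + 1 - (p + 1)) γ y z) =
      ev (c (1 + p)) (ev (c (N + 1 - (1 + p))) x y α) z (β * γ) -
        ev (c (1 + p)) x (ev (c (N + 1 - (1 + p))) y z γ) (α * β) := by
    intro p hp
    have hp := mem_range.mp hp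
    -- The inner index is positive as `p < N`, so both coefficients are values of `c` and not the
    -- undeformed product.
    obtain ⟨m, hm⟩ : ∃ m, N + 1 - (p + 1) = m + 1 := ⟨N - p - 1, by omega⟩
    rw [add_comm 1 p, hm]
    simp only [famCoeff_succ]
  rw [sum_congr rfl this]
  simp only [Nat.add_sub_cancel, Nat.sub_zero, Nat.sub_self, famCoeff_zero,
    famCoeff_succ, hc x, mul_assoc]
  abel

/-- Associativity modulo `t^N`, coefficient by coefficient. -/
theorem isAssocMod_iff (ε : B →ₐ[k] A) (hε : ∀ β : B, ε β ∈ Subalgebra.center k A)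
    (c : ℕ → Cochain k A B A 2) (N : ℕ) :
    IsAssocMod ε c (N + 1) ↔ ∀ i < N, δ ε A 2 (c (i + 1)) = obstruction c i := by
  rw [isAssocMod_iff_coeff_associator]
  constructor
  · intro h i hi
    refine (sub_eq_zero.mp (ext_evThree fun x y z α β γ => ?_)).symm
    rw [← coeff_succ_associator_C ε hε, h (i + 1) (by omega)]
    rfl
  · intro h i
    -- The equations control the associator on constants only; the induction hypothesis, for all
    -- series in lower degrees, is what permits the reduction to constants.
    induction i using Nat.strong_induction_on with
    | _ i ih =>
      intro hi α β γ x y z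
      rw [coeff_associator_eq_constantCoeff ε c fun j hj => ih j hj (hj.trans hi)]
      cases i with
      | zero => exact coeff_zero_associator ε hε ..
      | succ i =>
        rw [coeff_succ_associator_C ε hε, h i (by omega), sub_self]
        rfl

/-- Both `p` and `n + 1 - p` stay in `1, …, n`, so the obstruction does not see `c_{n+1}`, which may
be chosen freely. -/
theorem obstruction_congr {c d : ℕ → Cochain k A B A 2} {n : ℕ}
    (h : ∀ i, 1 ≤ i → i ≤ n → d i = c i) : obstruction d n = obstruction c n := by
  refine sum_congr rfl fun p hp => ?_
  have hp := mem_Icc.mp hp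
  rw [h p hp.1 hp.2, h (n + 1 - p) (by omega) (by omega)]

/-! ### The pentagon identity and the cocycle property of the obstruction -/

/-- A product of two blocks of arguments carries as parameter the product of all `b_{uv}` with `u`
in the left and `v` in the right block. Each of the five bracketings of four arguments then occurs
twice, with opposite signs; commutativity of `B` identifies the parameters. -/
theorem associator_pentagon (ε : B →ₐ[k] A) (c : ℕ → Cochain k A B A 2)
    (b₀₁ b₀₂ b₀₃ b₁₂ b₁₃ b₂₃ : B) (x₀ x₁ x₂ x₃ : A⟦X⟧) :
    famProd ε c (b₀₁ * b₀₂ * b₀₃) x₀ (associator ε c b₁₂ b₁₃ b₂₃ x₁ x₂ x₃)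
      - associator ε c (b₀₂ * b₁₂) (b₀₃ * b₁₃) b₂₃ (famProd ε c b₀₁ x₀ x₁) x₂ x₃
      + associator ε c (b₀₁ * b₀₂) b₀₃ (b₁₃ * b₂₃) x₀ (famProd ε c b₁₂ x₁ x₂) x₃
      - associator ε c b₀₁ (b₀₂ * b₀₃) (b₁₂ * b₁₃) x₀ x₁ (famProd ε c b₂₃ x₂ x₃)
      + famProd ε c (b₀₃ * b₁₃ * b₂₃) (associator ε c b₀₁ b₀₂ b₁₂ x₀ x₁ x₂) x₃ = 0 := by
  simp only [associator, map_sub, LinearMap.sub_apply]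
  rw [show b₀₂ * b₁₂ * (b₀₃ * b₁₃) = b₀₂ * b₀₃ * (b₁₂ * b₁₃) by ring,
    show b₀₃ * (b₁₃ * b₂₃) = b₀₃ * b₁₃ * b₂₃ by ring,
    show b₀₁ * (b₀₂ * b₀₃) = b₀₁ * b₀₂ * b₀₃ by ring]
  abel

/-- Any contribution other than the undeformed product of `coeff N x` and `coeff 0 y` uses a
coefficient of `x` below `N`. This and its mirror image treat the two pentagon terms in which an
associator is a factor. -/
theorem coeff_famProd_of_coeff_lt_left (ε : B →ₐ[k] A) (c : ℕ → Cochain k A B A 2) (α : B)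
    (x y : A⟦X⟧) (N : ℕ) (h : ∀ i < N, coeff i x = 0) :
    coeff N (famProd ε c α x y) = ε α * (coeff N x * coeff 0 y) := by
  rw [coeff_famProd, sum_eq_single (0, N)]
  · rw [sum_eq_single (N, 0)]
    · rw [famCoeff_zero]
    · rintro ⟨u, v⟩ huv hne
      have huv := mem_antidiagonal.mp huv
      rw [h u (by
        simp only [ne_eq, Prod.mk.injEq] at hne huv
        omega)]
      simp
    · simp
  · rintro ⟨p, r⟩ hpr hne
    have hpr := mem_antidiagonal.mp hpr
    refine sum_eq_zero ?_
    rintro ⟨u, v⟩ huv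
    have huv := mem_antidiagonal.mp huv
    rw [h u (by
      simp only [ne_eq, Prod.mk.injEq] at hne hpr huv
      omega)]
    simp
  · simp

theorem coeff_famProd_of_coeff_lt_right (ε : B →ₐ[k] A) (c : ℕ → Cochain k A B A 2) (α : B)
    (x y : A⟦X⟧) (N : ℕ) (h : ∀ i < N, coeff i y = 0) :
    coeff N (famProd ε c α x y) = ε α * (coeff 0 x * coeff N y) := by
  rw [coeff_famProd, sum_eq_single (0, N)]
  · rw [sum_eq_single (0, N)]
    · rw [famCoeff_zero]
    · rintro ⟨u, v⟩ huv hne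
      have huv := mem_antidiagonal.mp huv
      rw [h v (by
        simp only [ne_eq, Prod.mk.injEq] at hne huv
        omega)]
      simp
    · simp
  · rintro ⟨p, r⟩ hpr hne
    have hpr := mem_antidiagonal.mp hpr
    refine sum_eq_zero ?_
    rintro ⟨u, v⟩ huv
    have huv := mem_antidiagonal.mp huv
    rw [h v (by
      simp only [ne_eq, Prod.mk.injEq] at hne hpr huv
      omega)]
    simp
  · simp

theorem delta_obstruction (ε : B →ₐ[k] A) (hε : ∀ β : B, ε β ∈ Subalgebra.center k A)
    (c : ℕ → Cochain k A B A 2) (n : ℕ) (hc : IsAssocMod ε c (n + 1)) :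
    δ ε A 3 (obstruction c n) = 0 := by
  -- With the term of index `n + 1` set to zero, the leading coefficient of the associator is the
  -- obstruction itself, without a summand `δ c_{n+1}`; thus `δδ = 0` on degree `2` is not required.
  obtain ⟨d, hdc, hd⟩ : ∃ d : ℕ → Cochain k A B A 2,
      (∀ i, 1 ≤ i → i ≤ n → d i = c i) ∧ d (n + 1) = 0 :=
    ⟨Function.update c (n + 1) 0, fun i _ hi => Function.update_of_ne (by omega) _ _,
      Function.update_self ..⟩
  have hassoc : IsAssocMod ε d (n + 1) := by
    rw [isAssocMod_iff ε hε] at hc ⊢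
    intro i hi
    rw [hdc (i + 1) (by omega) (by omega), hc i hi,
      obstruction_congr fun j hj hj' => hdc j hj (by omega)]
  rw [isAssocMod_iff_coeff_associator] at hassoc
  have key : ∀ α β γ x y z, coeff (n + 1) (associator ε d α β γ x y z) =
      evThree (obstruction c n) (coeff 0 x) (coeff 0 y) (coeff 0 z) α β γ := by
    intro α β γ x y z
    rw [coeff_associator_eq_constantCoeff ε d hassoc, coeff_succ_associator_C ε hε, hd, map_zero,
      sub_zero, obstruction_congr hdc]
  have hcomm : ∀ x β, x * ε β = ε β * x := fun x β => Subalgebra.mem_center_iff.mp (hε β) x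
  refine Cochain.ext_eval fun a b => ?_
  rw [eval_delta_three, Cochain.eval_zero, hcomm]
  have h := congrArg (coeff (n + 1)) (associator_pentagon ε d (b (pos 0 1 (by decide)))
    (b (pos 0 2 (by decide))) (b (pos 0 3 (by decide))) (b (pos 1 2 (by decide)))
    (b (pos 1 3 (by decide))) (b (pos 2 3 (by decide))) (C (a 0)) (C (a 1)) (C (a 2)) (C (a 3)))
  rw [map_add, map_sub, map_add, map_sub,
    coeff_famProd_of_coeff_lt_left _ _ _ _ _ _ fun i hi => hassoc i hi ..,
    coeff_famProd_of_coeff_lt_right _ _ _ _ _ _ fun i hi => hassoc i hi ..] at h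
  simp only [key, coeff_zero_famProd, coeff_zero_C, map_zero] at h
  rw [mul_assoc (ε _) (a 0)]
  exact h

/-! ### Isomorphic families -/

/-- The cochain of degree `1` given by a linear map. -/
noncomputable def ofLinearMap (B : Type*) [CommRing B] [Algebra k B] (f : A →ₗ[k] A) :
    Cochain k A B A 1 :=
  Cochain.ofFun (fun a _ => f (a 0))
    (fun a _ j => ⟨f, fun x => by rw [Subsingleton.elim j 0, Function.update_self]⟩)
    (fun _ _ p => absurd p.2 (by omega))

theorem evOne_ofLinearMap (f : A →ₗ[k] A) (a : A) : evOne (ofLinearMap B f) a = f a := by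
  simp [evOne, ofLinearMap]

/-- The cocycles of isomorphic families differ by the coboundary of the linear term of the
isomorphism. -/
theorem exists_delta_eq_sub_of_isIsomorphic (ε : B →ₐ[k] A)
    (hε : ∀ β : B, ε β ∈ Subalgebra.center k A)
    (c d : ℕ → Cochain k A B A 2) (h : IsIsomorphic ε c d) :
    ∃ f : Cochain k A B A 1, δ ε A 1 f = c 1 - d 1 := by
  obtain ⟨φ, hφ, hφ0, hφm⟩ := h
  -- Commuting with `X` extends the normalisation of `φ` from constants to all series: `φ` is the
  -- identity mod `t`, and its coefficient at `t` is determined by its linear term on constants.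
  have hX : ∀ x, φ (X * x) = X * φ x := fun x => by simpa using hφ X x
  have h0 : ∀ x, coeff 0 (φ x) = coeff 0 x := by
    intro x
    conv_lhs => rw [eq_X_mul_shift_add_const x, map_add, hX]
    simp [hφ0]
  have h1 : ∀ x, coeff 1 (φ x) = coeff 1 x + coeff 1 (φ (C (coeff 0 x))) := by
    intro x
    conv_lhs => rw [eq_X_mul_shift_add_const x, map_add, hX, map_add, coeff_succ_X_mul, h0]
    simp
  let f : A →ₗ[k] A :=
    { toFun := fun a => coeff 1 (φ (C a))
      map_add' := fun a b => by simp
      map_smul' := fun r a => by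
        have : (C (r • a) : A⟦X⟧) = r • C a := by ext; simp [coeff_C]
        rw [this, map_smul, LinearMap.map_smul_of_tower]
        rfl }
  have hf : ∀ a, coeff 1 (φ (C a)) = f a := fun _ => rfl
  refine ⟨ofLinearMap B f, ext_ev fun a b α => ?_⟩
  have h := congrArg (coeff 1) (hφm α (C a) (C b))
  rw [h1, coeff_one_famProd, coeff_one_famProd] at h
  simp only [h0, hf, coeff_zero_famProd, coeff_zero_C, coeff_succ_C, mul_zero, zero_mul,
    zero_add] at h
  have hs : ev (c 1 - d 1) a b α = ev (c 1) a b α - ev (d 1) a b α := rfl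
  rw [hs, ev_delta, Subalgebra.mem_center_iff.mp (hε α) a, mul_assoc]
  simp only [evOne_ofLinearMap]
  rw [eq_sub_of_add_eq h]
  abel

/-! ### Translation into cohomology classes -/

theorem cohomologyClass_eq_iff (ε : B →ₐ[k] A) {n : ℕ} (z w : cocycles ε A (n + 1)) :
    cohomologyClass ε A z = cohomologyClass ε A w ↔
      ∃ f, δ ε A n f = (z : Cochain k A B A (n + 1)) - w := by
  rw [cohomologyClass, cohomologyClass, Submodule.Quotient.eq]
  -- In degree `n + 1` the coboundaries are by definition the range of `δ ε A n`.
  rfl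

theorem cohomologyClass_eq_zero_iff (ε : B →ₐ[k] A) {n : ℕ} (z : cocycles ε A (n + 1)) :
    cohomologyClass ε A z = 0 ↔ ∃ f, δ ε A n f = (z : Cochain k A B A (n + 1)) := by
  rw [cohomologyClass, Submodule.Quotient.mk_eq_zero]
  rfl

theorem isAssocMod_two_iff (ε : B →ₐ[k] A) (hε : ∀ β : B, ε β ∈ Subalgebra.center k A)
    (c : ℕ → Cochain k A B A 2) : IsAssocMod ε c 2 ↔ c 1 ∈ cocycles ε A 2 := by
  rw [isAssocMod_iff ε hε, cocycles, LinearMap.mem_ker]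
  -- The only equation is the one for `i = 0`, and its obstruction is an empty sum.
  simp [obstruction]

/-- The equations with `i < n` involve only the prescribed terms and hold already. The one for `i =
n` asks that `c' (n + 1)` be a primitive of the obstruction, which is itself fixed by the prescribed
terms. -/
theorem exists_isAssocMod_extension_iff (ε : B →ₐ[k] A)
    (hε : ∀ β : B, ε β ∈ Subalgebra.center k A) (c : ℕ → Cochain k A B A 2) (n : ℕ)
    (hc : IsAssocMod ε c (n + 1)) :
    (∃ c' : ℕ → Cochain k A B A 2,
      (∀ i, 1 ≤ i → i ≤ n → c' i = c i) ∧ IsAssocMod ε c' (n + 2)) ↔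
    ∃ f, δ ε A 2 f = obstruction c n := by
  simp only [isAssocMod_iff ε hε] at hc ⊢
  constructor
  · rintro ⟨c', hc', h⟩
    exact ⟨c' (n + 1), by rw [h n (Nat.lt_succ_self n), obstruction_congr hc']⟩
  · rintro ⟨f, hf⟩
    have hu : ∀ i, 1 ≤ i → i ≤ n → Function.update c (n + 1) f i = c i :=
      fun i _ hi => Function.update_of_ne (by omega) _ _
    refine ⟨Function.update c (n + 1) f, hu, fun i hi => ?_⟩
    rw [obstruction_congr fun j hj hj' => hu j hj (by omega)]
    rcases Nat.lt_succ_iff_lt_or_eq.mp hi with hi | rfl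
    · rw [hu (i + 1) (by omega) (by omega), hc i hi]
    · rw [Function.update_self, hf]

end Associators

end SecondaryHochschild

theorem mainTheorem1 {k A B : Type*} [Field k] [Ring A] [Algebra k A] [CommRing B] [Algebra k B]
    (ε : B →ₐ[k] A) (hε : ∀ β : B, ε β ∈ Subalgebra.center k A) :
    (∀ c : ℕ → SecondaryHochschild.Cochain k A B A 2,
      SecondaryHochschild.IsAssocMod ε c 2 ↔ c 1 ∈ SecondaryHochschild.cocycles ε A 2) ∧
    (∀ c d : ℕ → SecondaryHochschild.Cochain k A B A 2,
      SecondaryHochschild.IsAssocMod ε c 2 → SecondaryHochschild.IsIsomorphic ε c d →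
      ∃ (hc : c 1 ∈ SecondaryHochschild.cocycles ε A 2)
        (hd : d 1 ∈ SecondaryHochschild.cocycles ε A 2),
        SecondaryHochschild.cohomologyClass ε A ⟨c 1, hc⟩ =
          SecondaryHochschild.cohomologyClass ε A ⟨d 1, hd⟩) ∧
    (∀ (c : ℕ → SecondaryHochschild.Cochain k A B A 2) (n : ℕ),
      SecondaryHochschild.IsAssocMod ε c (n + 1) →
      ∃ h : SecondaryHochschild.obstruction c n ∈ SecondaryHochschild.cocycles ε A 3,
        ((∃ c' : ℕ → SecondaryHochschild.Cochain k A B A 2,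
          (∀ i, 1 ≤ i → i ≤ n → c' i = c i) ∧ SecondaryHochschild.IsAssocMod ε c' (n + 2)) ↔
        SecondaryHochschild.cohomologyClass ε A ⟨SecondaryHochschild.obstruction c n, h⟩ = 0)) := by
  refine ⟨SecondaryHochschild.isAssocMod_two_iff ε hε, fun c d hc h => ?_, fun c n hc => ?_⟩
  · have hc1 := (SecondaryHochschild.isAssocMod_two_iff ε hε c).mp hc
    obtain ⟨f, hf⟩ := SecondaryHochschild.exists_delta_eq_sub_of_isIsomorphic ε hε c d h
    have hd1 : d 1 ∈ SecondaryHochschild.cocycles ε A 2 := by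
      -- No associativity of the second family is assumed: `d 1` is a cocycle because it is `c 1`
      -- minus a coboundary.
      rw [← sub_sub_cancel (c 1) (d 1), ← hf]
      exact sub_mem hc1 (SecondaryHochschild.delta_delta_one ε hε f)
    exact ⟨hc1, hd1, (SecondaryHochschild.cohomologyClass_eq_iff ε _ _).mpr ⟨f, hf⟩⟩
  · refine ⟨SecondaryHochschild.delta_obstruction ε hε c n hc, ?_⟩
    rw [SecondaryHochschild.cohomologyClass_eq_zero_iff]
    exact SecondaryHochschild.exists_isAssocMod_extension_iff ε hε c n hc
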